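/- Let $\mathcal K$ be a separable complex Hilbert space. For a linear operator $T$ in $\mathcal K$ with domain $\mathrm{dom}(T)$ (a linear subspace, not necessarily dense), let $\rho(T)$ be the set of all $z\in\mathbb C$ for which $T-zI\colon \mathrm{dom}(T)\to\mathcal K$ is bijective with bounded inverse, and let $\sigma(T)=\mathbb C\setminus\rho(T)$. Let the discrete spectrum $\sigma_d(T)$ be the set of all eigenvalues $\lambda$ of $T$ that are isolated points of $\sigma(T)$ and whose Riesz projection $$P(\lambda;T)=\frac{-1}{2\pi i}\oint_{|\zeta-\lambda|=\varepsilon}(T-\zeta I)^{-1}\,d\zeta$$ ($\varepsilon>0$ so small that $\sigma(T)\cap\{\zeta\in\mathbb C : |\zeta-\lambda|\le\varepsilon\}=\{\lambda\}$) has finite-dimensional range. Put $\widetilde\rho(T)=\rho(T)\cup\sigma_d(T)$ and $\widetilde\sigma_{ess}(T)=\sigma(T)\setminus\sigma_d(T)$. **Corollary 6.4.** Let $A$ be a closed operator in $\mathcal K$ with $\rho(A)\neq\emptyset$, and let $B$ be a linear operator in $\mathcal K$ with $\mathrm{dom}(B)\supseteq\mathrm{dom}(A)$ such that $B(A-zI)^{-1}$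 is a compact operator on $\mathcal K$ for some $z\in\rho(A)$. Let $A+B$ be the operator sum, with domain $\mathrm{dom}(A+B)=\mathrm{dom}(A)$. Suppose that each connected component of $\widetilde\rho(A)$ contains a point of $\rho(A+B)$, and that each connected component of $\widetilde\rho(A+B)$ contains a point of $\rho(A)$. Then $$\widetilde\rho(A+B)=\widetilde\rho(A),\quad\text{equivalently,}\quad \widetilde\sigma_{ess}(A+B)=\widetilde\sigma_{ess}(A).$$ -/

import Mathlib

/-! Spectral notions for (possibly unbounded, not necessarily densely defined) linear operators
`T` in a complex Hilbert space, modelled as `T : K →ₗ.[ℂ] K`. -/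

namespace LinearPMap

variable {K : Type*} [NormedAddCommGroup K] [InnerProductSpace ℂ K]

/-- `R` is a bounded, everywhere defined two-sided inverse of `T - z I : dom(T) → K`. -/
def IsResolventAt (T : K →ₗ.[ℂ] K) (z : ℂ) (R : K →L[ℂ] K) : Prop :=
  (∀ y : K, ∃ h : R y ∈ T.domain, T ⟨R y, h⟩ - z • R y = y) ∧
    ∀ x : T.domain, R (T x - z • (x : K)) = x

/-- The resolvent set `ρ(T)`: those `z` for which `T - z I : dom(T) → K` is a bijection with
bounded inverse. -/
def resolventSet (T : K →ₗ.[ℂ] K) : Set ℂ :=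
  {z | ∃ R : K →L[ℂ] K, IsResolventAt T z R}

/-- The spectrum `σ(T) = ℂ \ ρ(T)`. -/
def spectrum (T : K →ₗ.[ℂ] K) : Set ℂ :=
  (resolventSet T)ᶜ

open Classical in
/-- The resolvent `(T - z I)⁻¹` for `z ∈ ρ(T)` (and `0` otherwise). -/
noncomputable def resolvent (T : K →ₗ.[ℂ] K) (z : ℂ) : K →L[ℂ] K :=
  if h : ∃ R : K →L[ℂ] K, IsResolventAt T z R then h.choose else 0

/-- The resolvent is an inverse of `T - z I` for `z ∈ ρ(T)`. -/
theorem isResolventAt_resolvent {T : K →ₗ.[ℂ] K} {z : ℂ} (hz : z ∈ resolventSet T) :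
    IsResolventAt T z (resolvent T z) := by
  have h : ∃ R : K →L[ℂ] K, IsResolventAt T z R := hz
  rw [resolvent, dif_pos h]
  exact h.choose_spec

/-- The inverse of `T - z I` is unique. -/
theorem IsResolventAt.eq {T : K →ₗ.[ℂ] K} {z : ℂ} {R S : K →L[ℂ] K}
    (hR : IsResolventAt T z R) (hS : IsResolventAt T z S) : R = S := by
  ext y
  obtain ⟨h, hy⟩ := hR.1 y
  have := hS.2 ⟨R y, h⟩
  rw [hy] at this
  exact this.symm

/-- The point spectrum `σ_p(T)`: the set of eigenvalues of `T`. -/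
def pointSpectrum (T : K →ₗ.[ℂ] K) : Set ℂ :=
  {z | ∃ x : T.domain, (x : K) ≠ 0 ∧ T x = z • (x : K)}

/-- The Riesz projection
`P(c; T) = (-1 / (2 π i)) ∮_{|ζ - c| = ε} (T - ζ I)⁻¹ dζ`, computed on the counterclockwise circle
of radius `ε` (an integral in the space of bounded operators with its operator norm). It is used
for `ε` so small that the closed disk of radius `ε` meets `σ(T)` only in `c`; its value does not
depend on such an `ε`. -/
noncomputable def rieszProjection (T : K →ₗ.[ℂ] K) (c : ℂ) (ε : ℝ) : K →L[ℂ] K :=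
  (-1 / (2 * (Real.pi : ℂ) * Complex.I)) • circleIntegral (fun ζ => resolvent T ζ) c ε

/-- The discrete spectrum `σ_d(T)`: the eigenvalues of `T` that are isolated points of `σ(T)` and
whose Riesz projection has finite-dimensional range. -/
def discreteSpectrum (T : K →ₗ.[ℂ] K) : Set ℂ :=
  {c | c ∈ pointSpectrum T ∧ ∃ ε : ℝ, 0 < ε ∧ Metric.closedBall c ε ∩ spectrum T = {c} ∧
    FiniteDimensional ℂ (LinearMap.range (rieszProjection T c ε : K →ₗ[ℂ] K))}

/-- The extended resolvent set `ρ̃(T) = ρ(T) ∪ σ_d(T)`. -/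
def extendedResolventSet (T : K →ₗ.[ℂ] K) : Set ℂ :=
  resolventSet T ∪ discreteSpectrum T

/-- The essential spectrum `σ(T) \ σ_d(T)`. -/
def essentialSpectrum (T : K →ₗ.[ℂ] K) : Set ℂ :=
  spectrum T \ discreteSpectrum T

/-- For `z ∈ ρ(A)`: the operator `B (A - z I)⁻¹` is defined on all of `K`, bounded and compact;
`C` is that operator, since `(x, y) ∈ B.graph` says that `x ∈ dom(B)` and `B x = y`. -/
def IsCompactMulResolventAt (A B : K →ₗ.[ℂ] K) (z : ℂ) : Prop :=
  ∃ C : K →L[ℂ] K, IsCompactOperator C ∧ ∀ y : K, (resolvent A z y, C y) ∈ B.graph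

end LinearPMap

/-! Fix `w` in the resolvent set of `A` and let R = (A - w)⁻¹. Then (A - z)R = N(z) with N(z) = 1 +
(w - z)R, and (A + B - z)R = N(z) + C with C = BR compact. Since R maps bijectively onto the common
domain, both spectra are read off bounded pencils affine in z (`IsQuotient.mem_resolventSet_iff`).

On the extended resolvent set the pencil is invertible plus compact
(`isUnitAddCompact_of_mem_discreteSpectrum`), a property unaffected by adding C. Conversely, where
the pencil has this property, the analytic Fredholm theorem
(`IsUnitAddCompact.exists_local_inverse`) leaves two cases: a punctured neighbourhood lies in the
resolvent set, or a full neighbourhood lies in the spectrum. One resolvent point excludes the second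
case on its whole component, and then every spectral point there is discrete
(`mem_discreteSpectrum`). This gives one inclusion; the other is the same statement for the pair A +
B, -B. -/

open Filter Topology Metric

/-! ### Compact perturbations of invertible operators. -/

section Operators

variable {K : Type*} [NormedAddCommGroup K] [InnerProductSpace ℂ K]

/-- A compact operator on a Hilbert space is a norm limit of operators of finite rank. -/
theorem IsCompactOperator.exists_finiteDimensional_range_norm_sub_le {C : K →L[ℂ] K}
    (hC : IsCompactOperator C) {ε : ℝ} (hε : 0 < ε) :
    ∃ F : K →L[ℂ] K, FiniteDimensional ℂ (LinearMap.range (F : K →ₗ[ℂ] K)) ∧ ‖C - F‖ ≤ ε := by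
  have hcpt := hC.isCompact_closure_image_closedBall (f := (C : K →ₗ[ℂ] K)) 1
  obtain ⟨t, htfin, ht⟩ :=
    Metric.totallyBounded_iff.1 (hcpt.totallyBounded.subset subset_closure) ε hε
  -- The centres of a finite ε-net of the image of the unit ball span V; projecting onto V moves
  -- that image by at most ε.
  let V : Submodule ℂ K := Submodule.span ℂ t
  have : FiniteDimensional ℂ V := FiniteDimensional.span_of_finite ℂ htfin
  refine ⟨V.starProjection ∘L C, ?_, ?_⟩
  · refine Submodule.finiteDimensional_of_le (S₂ := V) ?_
    rintro _ ⟨x, rfl⟩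
    exact Submodule.starProjection_apply_mem V (C x)
  · refine ContinuousLinearMap.opNorm_le_of_unit_norm hε.le fun x hx => ?_
    have hmem : C x ∈ (C : K →ₗ[ℂ] K) '' closedBall 0 1 := ⟨x, by simp [hx], rfl⟩
    obtain ⟨y, hy, hxy⟩ := Set.mem_iUnion₂.1 (ht hmem)
    have hyV : y ∈ V := Submodule.subset_span hy
    calc ‖(C - V.starProjection ∘L C) x‖ = ‖C x - V.starProjection (C x)‖ := rfl
      _ = ⨅ w : V, ‖C x - w‖ := Submodule.starProjection_minimal (C x)
      _ ≤ ‖C x - (⟨y, hyV⟩ : V)‖ :=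
        ciInf_le ⟨0, by rintro _ ⟨w, rfl⟩; exact norm_nonneg _⟩ (⟨y, hyV⟩ : V)
      _ ≤ ε := by rw [← dist_eq_norm]; exact (mem_ball.1 hxy).le

theorem isCompactOperator_of_finiteDimensional_range {F : K →L[ℂ] K}
    (hF : FiniteDimensional ℂ (LinearMap.range (F : K →ₗ[ℂ] K))) : IsCompactOperator F := by
  have : ProperSpace (LinearMap.range (F : K →ₗ[ℂ] K)) := FiniteDimensional.proper ℂ _
  have h := isCompactOperator_of_locallyCompactSpace_dom
    (T := F.codRestrict (LinearMap.range (F : K →ₗ[ℂ] K)) fun x => ⟨x, rfl⟩)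
  exact h.clm_comp (LinearMap.range (F : K →ₗ[ℂ] K)).subtypeL

/-- Invertible plus compact: the bounded Fredholm operators of index zero. -/
def IsUnitAddCompact (N : K →L[ℂ] K) : Prop :=
  ∃ G C : K →L[ℂ] K, IsUnit G ∧ IsCompactOperator C ∧ N = G + C

theorem IsUnit.isUnitAddCompact {N : K →L[ℂ] K} (hN : IsUnit N) : IsUnitAddCompact N :=
  ⟨N, 0, hN, isCompactOperator_zero, (add_zero N).symm⟩

theorem IsUnitAddCompact.add_isCompactOperator {N C : K →L[ℂ] K} (hN : IsUnitAddCompact N)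
    (hC : IsCompactOperator C) : IsUnitAddCompact (N + C) := by
  obtain ⟨G, C', hG, hC', rfl⟩ := hN
  exact ⟨G, C' + C, hG, hC'.add hC, add_assoc _ _ _⟩

/-- Invertibility is an open condition, so the small difference between the compact part and a
finite-rank approximation can be absorbed into the invertible part. -/
theorem IsUnitAddCompact.exists_finiteDimensional_range [CompleteSpace K] {N : K →L[ℂ] K} (hN : IsUnitAddCompact N) :
    ∃ G F : K →L[ℂ] K, IsUnit G ∧ FiniteDimensional ℂ (LinearMap.range (F : K →ₗ[ℂ] K)) ∧
      N = G + F := by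
  obtain ⟨G, C, hG, hC, rfl⟩ := hN
  obtain ⟨ε, hε, hball⟩ := Metric.isOpen_iff.1 (Units.isOpen (R := K →L[ℂ] K)) G hG
  obtain ⟨F, hF, hCF⟩ := hC.exists_finiteDimensional_range_norm_sub_le (half_pos hε)
  refine ⟨G + (C - F), F, hball ?_, hF, by abel⟩
  rw [mem_ball, dist_eq_norm, add_sub_cancel_left]
  linarith

/-- If `N S = 1 - P` with `P` compact, and `N` is a limit of invertible operators, then `N` is
invertible plus compact. -/
theorem IsUnitAddCompact.of_mul_eq_one_sub [CompleteSpace K] {N S P R : K →L[ℂ] K} (h : N * S = 1 - P)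
    (hP : IsCompactOperator P) (hR : ∃ᶠ t : ℂ in 𝓝 0, IsUnit (N - t • R)) :
    IsUnitAddCompact N := by
  -- With M = N - tR and E = 1 - tRS both invertible for a suitable small t, MS = E - P. Hence S is
  -- itself invertible minus compact, S = U - Q, and NU = 1 + (NQ - P) can be solved for N.
  have hE : ∀ᶠ t : ℂ in 𝓝 0, IsUnit (1 - t • (R * S)) := by
    have hc : ContinuousAt (fun t : ℂ => (1 : K →L[ℂ] K) - t • (R * S)) 0 := by fun_prop
    exact hc.eventually (Units.isOpen.mem_nhds (by simp))
  obtain ⟨t, ht, ⟨E, hE⟩⟩ := (hR.and_eventually hE).exists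
  obtain ⟨M, hM⟩ := ht
  have hMS : (M : K →L[ℂ] K) * S = E - P := by
    rw [hM, hE, sub_mul, h, smul_mul_assoc]; abel
  have hS : S = ((M⁻¹ * E : (K →L[ℂ] K)ˣ) : K →L[ℂ] K) - ((M⁻¹ : (K →L[ℂ] K)ˣ) : K →L[ℂ] K) * P := by
    rw [Units.val_mul, ← mul_sub, ← hMS, Units.inv_mul_cancel_left]
  set U := M⁻¹ * E
  set Q : K →L[ℂ] K := ((M⁻¹ : (K →L[ℂ] K)ˣ) : K →L[ℂ] K) * P
  have hQ : IsCompactOperator Q := hP.clm_comp _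
  have hN : N = ((U⁻¹ : (K →L[ℂ] K)ˣ) : K →L[ℂ] K) + (N * Q - P) * ((U⁻¹ : (K →L[ℂ] K)ˣ) : K →L[ℂ] K) := by
    have h1 : N * U = 1 + (N * Q - P) := by
      rw [show (U : K →L[ℂ] K) = S + Q by rw [hS]; abel, mul_add, h]; abel
    calc N = N * U * ((U⁻¹ : (K →L[ℂ] K)ˣ) : K →L[ℂ] K) := by rw [Units.mul_inv_cancel_right]
      _ = _ := by rw [h1, add_mul, one_mul]
  refine ⟨_, _, Units.isUnit U⁻¹, ?_, hN⟩
  have : IsCompactOperator (N * Q - P) := (hQ.clm_comp N).sub hP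
  exact this.comp_clm _

end Operators

/-! ### Unbounded operators as quotients of bounded ones. -/

namespace LinearPMap

variable {K : Type*} [NormedAddCommGroup K] [InnerProductSpace ℂ K]

/-- `T = L R⁻¹` with bounded operators `L` and `R`, where `R` is injective. -/
structure IsQuotient (T : K →ₗ.[ℂ] K) (L R : K →L[ℂ] K) : Prop where
  injective : Function.Injective R
  exists_apply_eq : ∀ y, ∃ h : R y ∈ T.domain, T ⟨R y, h⟩ = L y
  exists_eq : ∀ x ∈ T.domain, ∃ y, R y = x

namespace IsQuotient

variable {T : K →ₗ.[ℂ] K} {L R : K →L[ℂ] K}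

theorem isResolventAt (h : IsQuotient T L R) {z : ℂ} (hz : IsUnit (L - z • R)) :
    IsResolventAt T z (R * Ring.inverse (L - z • R)) := by
  constructor
  · intro y
    obtain ⟨hd, he⟩ := h.exists_apply_eq (Ring.inverse (L - z • R) y)
    refine ⟨hd, ?_⟩
    have := DFunLike.congr_fun (Ring.mul_inverse_cancel _ hz) y
    simp only [mul_apply_eq_comp] at he ⊢
    rw [he]
    simpa using this
  · rintro ⟨x, hx⟩
    obtain ⟨y, rfl⟩ := h.exists_eq x hx
    obtain ⟨hd, he⟩ := h.exists_apply_eq y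
    have := DFunLike.congr_fun (Ring.inverse_mul_cancel _ hz) y
    rw [he]
    simp only [mul_apply_eq_comp] at this ⊢
    exact congrArg R this

/-- L - zR = (T - z)R, where R is a bijection onto the domain of T; bijectivity of a bounded
operator suffices by the open mapping theorem. -/
theorem mem_resolventSet_iff [CompleteSpace K] (h : IsQuotient T L R) {z : ℂ} :
    z ∈ T.resolventSet ↔ IsUnit (L - z • R) := by
  refine ⟨?_, fun hz => ⟨_, h.isResolventAt hz⟩⟩
  rintro ⟨S, hS⟩
  rw [ContinuousLinearMap.isUnit_iff_bijective]
  constructor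
  · refine (injective_iff_map_eq_zero _).2 fun y hy => ?_
    obtain ⟨hd, he⟩ := h.exists_apply_eq y
    have := hS.2 ⟨R y, hd⟩
    rw [he] at this
    have h0 : L y - z • R y = 0 := by simpa using hy
    simp only [h0, _root_.map_zero] at this
    exact h.injective (by rw [← this, _root_.map_zero])
  · intro y
    obtain ⟨hd, he⟩ := hS.1 y
    obtain ⟨u, hu⟩ := h.exists_eq _ hd
    obtain ⟨hd', he'⟩ := h.exists_apply_eq u
    refine ⟨u, ?_⟩
    have h2 : T ⟨R u, hd'⟩ = T ⟨S y, hd⟩ := by congr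
    simp only [_root_.sub_apply, _root_.smul_apply]
    rw [← he', h2, hu, he]

theorem resolvent_eq (h : IsQuotient T L R) {z : ℂ} (hz : IsUnit (L - z • R)) :
    resolvent T z = R * Ring.inverse (L - z • R) :=
  (isResolventAt_resolvent ⟨_, h.isResolventAt hz⟩).eq (h.isResolventAt hz)

theorem mem_pointSpectrum (h : IsQuotient T L R) {z : ℂ} {y : K} (hy : y ≠ 0)
    (hz : (L - z • R) y = 0) : z ∈ T.pointSpectrum := by
  obtain ⟨hd, he⟩ := h.exists_apply_eq y
  refine ⟨⟨R y, hd⟩, fun h0 => hy (h.injective (h0.trans (_root_.map_zero R).symm)), ?_⟩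
  rw [he]
  exact sub_eq_zero.1 hz

theorem isOpen_resolventSet [CompleteSpace K] (h : IsQuotient T L R) : IsOpen T.resolventSet := by
  have : T.resolventSet = (fun z : ℂ => L - z • R) ⁻¹' {x | IsUnit x} :=
    Set.ext fun z => h.mem_resolventSet_iff
  rw [this]
  exact Units.isOpen.preimage (by fun_prop)

end IsQuotient

/-- `(A + B)(A - w I)⁻¹ = 1 + w (A - w I)⁻¹ + B (A - w I)⁻¹`. -/
theorem isQuotient_add {A B : K →ₗ.[ℂ] K} {w : ℂ} (hw : w ∈ A.resolventSet) {C : K →L[ℂ] K}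
    (hC : ∀ y, (resolvent A w y, C y) ∈ B.graph) :
    IsQuotient (A + B) (1 + w • resolvent A w + C) (resolvent A w) := by
  have hR := isResolventAt_resolvent hw
  refine ⟨fun x y hxy => ?_, fun y => ?_, fun x hx => ⟨_, hR.2 ⟨x, hx.1⟩⟩⟩
  · obtain ⟨hx, ex⟩ := hR.1 x
    obtain ⟨hy, ey⟩ := hR.1 y
    rw [← ex, ← ey]
    simp only [hxy]
  · obtain ⟨hd, he⟩ := hR.1 y
    have hb := mem_domain_of_mem_graph (hC y)
    have hCb := (image_iff hb).2 (hC y)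
    refine ⟨⟨hd, hb⟩, ?_⟩
    rw [add_apply]
    change A ⟨_, hd⟩ + B ⟨_, hb⟩ = _
    rw [← hCb, sub_eq_iff_eq_add.1 he]
    simp

theorem isQuotient_self {A : K →ₗ.[ℂ] K} {w : ℂ} (hw : w ∈ A.resolventSet) :
    IsQuotient A (1 + w • resolvent A w) (resolvent A w) := by
  have h := isQuotient_add (B := 0) (C := 0) hw fun y => by simp [mem_graph_iff]
  rwa [add_zero, add_zero] at h

end LinearPMap

/-! ### Holomorphic families: order of zeros, contour integrals, determinants. -/

theorem AnalyticAt.exists_eq_pow_smul {f : ℂ → ℂ} {c : ℂ} (hf : AnalyticAt ℂ f c)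
    (h : ∀ᶠ z in 𝓝[≠] c, f z ≠ 0) :
    ∃ (m : ℕ) (g : ℂ → ℂ), AnalyticAt ℂ g c ∧ g c ≠ 0 ∧ ∀ᶠ z in 𝓝 c, f z = (z - c) ^ m * g z := by
  have ht : analyticOrderAt f c ≠ ⊤ := by
    rw [Ne, analyticOrderAt_eq_top]
    intro h0
    obtain ⟨z, h1, h2⟩ := (h.and (h0.filter_mono nhdsWithin_le_nhds)).exists
    exact h1 h2
  obtain ⟨g, hg, hgc, hfg⟩ := hf.analyticOrderAt_ne_top.1 ht
  exact ⟨_, g, hg, hgc, hfg⟩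

section

variable {V W X : Type*} [NormedAddCommGroup V] [NormedSpace ℂ V] [CompleteSpace V]
  [NormedAddCommGroup W] [NormedSpace ℂ W] [CompleteSpace W]
  [NormedAddCommGroup X] [NormedSpace ℂ X]

theorem ContinuousLinearMap.comp_circleIntegral (Φ : V →L[ℂ] W) {f : ℂ → X →L[ℂ] V} {c : ℂ} {ε : ℝ}
    (hε : 0 ≤ ε) (hf : ContinuousOn f (sphere c ε)) :
    (∮ z in C(c, ε), Φ ∘L f z) = Φ ∘L ∮ z in C(c, ε), f z := by
  have h := (ContinuousLinearMap.compL ℂ X V W Φ).intervalIntegral_comp_comm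
    ((hf.circleIntegrable hε).out)
  simpa [circleIntegral] using h

/-- The principal part of a product through a finite-dimensional space has finite rank. -/
theorem finiteDimensional_range_circleIntegral [FiniteDimensional ℂ V] {c : ℂ} {ε r : ℝ} (hε : 0 < ε) (hr : ε < r)
    {Ψ : ℂ → X →L[ℂ] V} (hΨ : DifferentiableOn ℂ Ψ (ball c r)) (m : ℕ) :
    ∀ {Φ : ℂ → V →L[ℂ] W}, DifferentiableOn ℂ Φ (ball c r) →
      FiniteDimensional ℂ (LinearMap.range
        ((∮ z in C(c, ε), ((z - c) ^ m)⁻¹ • (Φ z ∘L Ψ z) : X →L[ℂ] W) : X →ₗ[ℂ] W)) := by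
  have hsub : closedBall c ε ⊆ ball c r := closedBall_subset_ball hr
  have hsph : sphere c ε ⊆ ball c r := sphere_subset_closedBall.trans hsub
  have hne : ∀ z ∈ sphere c ε, z - c ≠ 0 := fun z hz h0 => by
    rw [mem_sphere, dist_eq_norm, h0, norm_zero] at hz
    exact hε.ne hz
  have hinv : ∀ k : ℕ, ContinuousOn (fun z : ℂ => ((z - c) ^ k)⁻¹) (sphere c ε) := fun k =>
    ContinuousOn.inv₀ (by fun_prop) fun z hz => pow_ne_zero _ (hne z hz)
  induction m with
  | zero =>
    intro Φ hΦ
    have h : (∮ z in C(c, ε), ((z - c) ^ 0)⁻¹ • (Φ z ∘L Ψ z)) = 0 := by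
      refine DiffContOnCl.circleIntegral_eq_zero hε.le ?_
      have hd : DifferentiableOn ℂ (fun z => ((z - c) ^ 0)⁻¹ • (Φ z ∘L Ψ z)) (ball c r) := by
        simpa using hΦ.clm_comp hΨ
      exact hd.diffContOnCl_ball hsub
    refine Submodule.finiteDimensional_of_le (S₂ := (⊥ : Submodule ℂ W)) ?_
    rintro _ ⟨x, rfl⟩
    rw [h]
    exact Submodule.zero_mem _
  | succ m ih =>
    intro Φ hΦ
    -- Splitting Φ(z) = Φ(c) + (z - c) `dslope Φ c z` gives a term whose range lies in that of Φ(c),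
    -- and a term with a pole of order one less.
    have hΦ' : DifferentiableOn ℂ (dslope Φ c) (ball c r) :=
      (Complex.differentiableOn_dslope (ball_mem_nhds c (hε.trans hr))).2 hΦ
    have hΨc := hΨ.continuousOn.mono hsph
    have hc1 : ContinuousOn (fun z => ((z - c) ^ (m + 1))⁻¹ • Ψ z) (sphere c ε) :=
      (hinv (m + 1)).smul hΨc
    have hc2 : ContinuousOn (fun z => ((z - c) ^ m)⁻¹ • (dslope Φ c z ∘L Ψ z)) (sphere c ε) :=
      (hinv m).smul ((hΦ'.continuousOn.mono hsph).clm_comp hΨc)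
    have h : (∮ z in C(c, ε), ((z - c) ^ (m + 1))⁻¹ • (Φ z ∘L Ψ z)) =
        (Φ c ∘L ∮ z in C(c, ε), ((z - c) ^ (m + 1))⁻¹ • Ψ z) +
          ∮ z in C(c, ε), ((z - c) ^ m)⁻¹ • (dslope Φ c z ∘L Ψ z) := by
      rw [← (Φ c).comp_circleIntegral hε.le hc1, ← circleIntegral.integral_add
        (ContinuousOn.circleIntegrable hε.le (continuousOn_const.clm_comp hc1))
        (hc2.circleIntegrable hε.le)]
      refine circleIntegral.integral_congr hε.le fun z hz => ?_
      have hz := hne z hz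
      have h1 : Φ z = Φ c + (z - c) • dslope Φ c z := by rw [sub_smul_dslope]; abel
      have h2 : ((z - c) ^ (m + 1))⁻¹ * (z - c) = ((z - c) ^ m)⁻¹ := by
        rw [pow_succ, mul_inv, mul_assoc, inv_mul_cancel₀ hz, mul_one]
      simp only [h1, ContinuousLinearMap.add_comp, ContinuousLinearMap.smul_comp, smul_add,
        ContinuousLinearMap.comp_smul, smul_smul, h2]
    rw [h]
    have h1 := ih hΦ'
    have h2 : FiniteDimensional ℂ (LinearMap.range (Φ c : V →ₗ[ℂ] W)) := inferInstance
    refine Submodule.finiteDimensional_of_le (S₂ := LinearMap.range (Φ c : V →ₗ[ℂ] W) ⊔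
      LinearMap.range ((∮ z in C(c, ε), ((z - c) ^ m)⁻¹ • (dslope Φ c z ∘L Ψ z) :
        X →L[ℂ] W) : X →ₗ[ℂ] W)) ?_
    rintro _ ⟨x, rfl⟩
    exact Submodule.add_mem_sup ⟨_, rfl⟩ ⟨x, rfl⟩

end

/-- Determinant and adjugate of a holomorphic family of operators on a finite-dimensional space. -/
theorem exists_det_adjugate {V : Type*} [NormedAddCommGroup V] [NormedSpace ℂ V]
    [FiniteDimensional ℂ V] {D : ℂ → V →L[ℂ] V} {U : Set ℂ} (hD : DifferentiableOn ℂ D U) :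
    ∃ (d : ℂ → ℂ) (Q : ℂ → V →L[ℂ] V), DifferentiableOn ℂ d U ∧ DifferentiableOn ℂ Q U ∧
      (∀ z, D z * Q z = d z • 1) ∧ (∀ z, Q z * D z = d z • 1) ∧ ∀ z, d z = 0 → ∃ v, v ≠ 0 ∧ D z v = 0 := by
  classical
  let b := Module.finBasis ℂ V
  let M : ℂ → Matrix _ _ ℂ := fun z => LinearMap.toMatrix b b (D z : V →ₗ[ℂ] V)
  have hM : ∀ i j, DifferentiableOn ℂ (fun z => M z i j) U := fun i j => by
    let φ : (V →L[ℂ] V) →ₗ[ℂ] ℂ :=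
      { toFun := fun S => LinearMap.toMatrix b b (S : V →ₗ[ℂ] V) i j
        map_add' := fun S S' => by simp
        map_smul' := fun a S => by simp }
    exact φ.toContinuousLinearMap.differentiable.comp_differentiableOn hD
  have hdet : ∀ N : ℂ → Matrix (Fin (Module.finrank ℂ V)) (Fin (Module.finrank ℂ V)) ℂ,
      (∀ i j, DifferentiableOn ℂ (fun z => N z i j) U) →
      DifferentiableOn ℂ (fun z => (N z).det) U := fun N hN => by
    simp only [Matrix.det_apply]
    refine DifferentiableOn.fun_sum fun σ _ => DifferentiableOn.const_smul ?_ _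
    exact DifferentiableOn.fun_finsetProd fun i _ => hN _ _
  have hadj : ∀ i j, DifferentiableOn ℂ (fun z => (M z).adjugate i j) U := fun i j => by
    simp only [Matrix.adjugate_apply]
    refine hdet _ fun k l => ?_
    simp only [Matrix.updateRow_apply]
    split_ifs
    · exact differentiableOn_const _
    · exact hM k l
  refine ⟨fun z => (M z).det, fun z => (Matrix.toLin b b (M z).adjugate).toContinuousLinearMap,
    hdet M hM, ?_, fun z => ?_, fun z => ?_, fun z hz => ?_⟩
  · have : (fun z => (Matrix.toLin b b (M z).adjugate).toContinuousLinearMap) = fun z =>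
        ∑ i, ∑ j, (M z).adjugate i j •
          (Matrix.toLin b b (Matrix.single i j 1)).toContinuousLinearMap := by
      funext z
      conv_lhs => rw [Matrix.matrix_eq_sum_single (M z).adjugate]
      simp only [map_sum]
      refine Finset.sum_congr rfl fun i _ => Finset.sum_congr rfl fun j _ => ?_
      rw [← map_smul, ← map_smul, Matrix.smul_single, smul_eq_mul, mul_one]
    rw [this]
    exact DifferentiableOn.fun_sum fun i _ => DifferentiableOn.fun_sum fun j _ =>
      (hadj i j).smul_const _
  · apply ContinuousLinearMap.coe_injective
    apply (LinearMap.toMatrix b b).injective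
    have := Matrix.mul_adjugate (M z)
    rw [ContinuousLinearMap.toLinearMap_mul, Module.End.mul_eq_comp, LinearMap.toMatrix_comp b b b]
    simpa [M] using this
  · apply ContinuousLinearMap.coe_injective
    apply (LinearMap.toMatrix b b).injective
    have := Matrix.adjugate_mul (M z)
    rw [ContinuousLinearMap.toLinearMap_mul, Module.End.mul_eq_comp, LinearMap.toMatrix_comp b b b]
    simpa [M] using this
  · have h2 : (M z).det = LinearMap.det (D z : V →ₗ[ℂ] V) := LinearMap.det_toMatrix b _
    obtain ⟨v, hv, hv0⟩ := Submodule.exists_mem_ne_zero_of_ne_bot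
      (LinearMap.bot_lt_ker_of_det_eq_zero (h2.symm.trans hz)).ne'
    exact ⟨v, hv0, hv⟩

/-! ### Local analytic Fredholm theorem. -/

section LocalInverse

variable {K : Type*} [NormedAddCommGroup K] [InnerProductSpace ℂ K] [CompleteSpace K]

/-- Local form of the analytic Fredholm theorem: near a point where it is invertible plus compact,
a holomorphic family has an inverse which is holomorphic up to a finite-rank family divided by a
scalar function, and its kernel is nontrivial at the zeros of that function. -/
theorem IsUnitAddCompact.exists_local_inverse {N : ℂ → K →L[ℂ] K} (hN : Differentiable ℂ N) {c : ℂ}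
    (hc : IsUnitAddCompact (N c)) :
    ∃ V : Submodule ℂ K, FiniteDimensional ℂ V ∧
    ∃ (r : ℝ) (d : ℂ → ℂ) (Γ : ℂ → K →L[ℂ] K) (Φ : ℂ → V →L[ℂ] K) (Ψ : ℂ → K →L[ℂ] V),
      0 < r ∧ DifferentiableOn ℂ d (ball c r) ∧ DifferentiableOn ℂ Γ (ball c r) ∧
      DifferentiableOn ℂ Φ (ball c r) ∧ DifferentiableOn ℂ Ψ (ball c r) ∧
      (∀ z ∈ ball c r, d z ≠ 0 →
        IsUnit (N z) ∧ Ring.inverse (N z) = Γ z - (d z)⁻¹ • (Φ z ∘L Ψ z)) ∧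
      ∀ z ∈ ball c r, d z = 0 → ∃ y, y ≠ 0 ∧ N z y = 0 := by
  obtain ⟨G₀, F, hG₀, hF, hNc⟩ := hc.exists_finiteDimensional_range
  have hFN : Differentiable ℂ fun z => N z - F := hN.sub_const F
  obtain ⟨r, hr, hball⟩ := Metric.isOpen_iff.1
    ((Units.isOpen (R := K →L[ℂ] K)).preimage hFN.continuous) c
      (by simpa [hNc] using hG₀)
  let V : Submodule ℂ K := LinearMap.range (F : K →ₗ[ℂ] K)
  let J : V →L[ℂ] K := V.subtypeL
  let P : K →L[ℂ] V := F.codRestrict V fun x => ⟨x, rfl⟩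
  let Γ : ℂ → K →L[ℂ] K := fun z => Ring.inverse (N z - F)
  have hΓ : DifferentiableOn ℂ Γ (ball c r) := fun z hz => by
    have h1 : DifferentiableAt ℂ Ring.inverse (N z - F) := differentiableAt_inverse (hball hz)
    exact (DifferentiableAt.comp (f := fun z => N z - F) z h1 (hFN z)).differentiableWithinAt
  have hGΓ : ∀ z ∈ ball c r, ∀ x, N z (Γ z x) - F (Γ z x) = x := fun z hz x =>
    DFunLike.congr_fun (Ring.mul_inverse_cancel _ (hball hz)) x
  have hΓG : ∀ z ∈ ball c r, ∀ x, Γ z (N z x - F x) = x := fun z hz x =>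
    DFunLike.congr_fun (Ring.inverse_mul_cancel _ (hball hz)) x
  have hPJ : ∀ x, J (P x) = F x := fun x => rfl
  -- With F = JP, the inverse of (N - F) + JP is Γ - ΓJD⁻¹PΓ (Woodbury), so invertibility of N(z) is
  -- decided by D(z) on the finite-dimensional V.
  let D : ℂ → V →L[ℂ] V := fun z => 1 + P ∘L (Γ z ∘L J)
  have hDiff : DifferentiableOn ℂ D (ball c r) :=
    ((differentiableOn_const P).clm_comp (hΓ.clm_comp (differentiableOn_const J))).const_add 1
  obtain ⟨d, Q, hd, hQ, hDQ, hQD, hker⟩ := exists_det_adjugate hDiff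
  refine ⟨V, hF, r, d, Γ, fun z => Γ z ∘L (J ∘L Q z), fun z => P ∘L Γ z, hr, hd, hΓ,
    hΓ.clm_comp ((differentiableOn_const J).clm_comp hQ),
    (differentiableOn_const P).clm_comp hΓ, fun z hz hdz => ?_, fun z hz hdz => ?_⟩
  · have hDQ' : ∀ v, Q z v + P (Γ z (J (Q z v))) = d z • v := fun v =>
      DFunLike.congr_fun (hDQ z) v
    have hQD' : ∀ v, Q z (v + P (Γ z (J v))) = d z • v := fun v => DFunLike.congr_fun (hQD z) v
    set X : K →L[ℂ] K := Γ z - (d z)⁻¹ • ((Γ z ∘L (J ∘L Q z)) ∘L (P ∘L Γ z))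
    have hXx : ∀ x, X x = Γ z x - (d z)⁻¹ • Γ z (J (Q z (P (Γ z x)))) := fun x => rfl
    have hNX : N z * X = 1 := by
      ext x
      change N z (X x) = x
      have h1 := hGΓ z hz x
      have h2 := hGΓ z hz (J (Q z (P (Γ z x))))
      have h3 := congrArg J (hDQ' (P (Γ z x)))
      rw [map_add, map_smul, hPJ, hPJ] at h3
      rw [hXx, map_sub, map_smul, sub_eq_iff_eq_add.1 h1, sub_eq_iff_eq_add.1 h2, h3, smul_smul,
        inv_mul_cancel₀ hdz, one_smul, add_sub_cancel_right]
    have hXN : X * N z = 1 := by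
      ext x
      change X (N z x) = x
      have h1 : Γ z (N z x) = x + Γ z (J (P x)) := by
        have := hΓG z hz x
        rw [map_sub] at this
        rw [hPJ, ← sub_eq_iff_eq_add, this]
      rw [hXx, h1, map_add, hQD', map_smul, map_smul, smul_smul, inv_mul_cancel₀ hdz, one_smul,
        add_sub_cancel_right]
    exact ⟨⟨⟨N z, X, hNX, hXN⟩, rfl⟩, Ring.inverse_unit ⟨N z, X, hNX, hXN⟩⟩
  -- For v in the kernel of D(z), the vector ΓJv works: N(z)ΓJv = Jv + FΓJv = J(D(z)v) = 0.
  · obtain ⟨v, hv, hv0⟩ := hker z hdz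
    have hv1 : J v + F (Γ z (J v)) = 0 := by
      have := congrArg J (show v + P (Γ z (J v)) = 0 from hv0)
      rwa [map_add, map_zero, hPJ] at this
    have h1 := hGΓ z hz (J v)
    refine ⟨Γ z (J v), fun h0 => hv ?_, by rw [sub_eq_iff_eq_add.1 h1, hv1]⟩
    rw [h0, map_zero, add_zero] at hv1
    exact Subtype.ext hv1

end LocalInverse

/-! ### Discrete spectrum in terms of the pencil. -/

namespace LinearPMap.IsQuotient

variable {K : Type*} [NormedAddCommGroup K] [InnerProductSpace ℂ K] [CompleteSpace K]
  {T : K →ₗ.[ℂ] K} {L R : K →L[ℂ] K}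

/-- The scalar function d of the local inverse either vanishes near c or is nonzero on a punctured
neighbourhood; its zeros are exactly where the pencil has a kernel. -/
theorem eventually_mem_resolventSet_or (h : IsQuotient T L R) {c : ℂ}
    (hc : IsUnitAddCompact (L - c • R)) :
    (∀ᶠ z in 𝓝[≠] c, z ∈ T.resolventSet) ∨ ∀ᶠ z in 𝓝 c, z ∉ T.resolventSet := by
  obtain ⟨V, -, r, d, Γ, Φ, Ψ, hr, hd, -, -, -, hunit, hker⟩ :=
    IsUnitAddCompact.exists_local_inverse (N := fun z => L - z • R) (by fun_prop) hc
  have hmem := ball_mem_nhds c hr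
  rcases (hd.analyticAt hmem).eventually_eq_zero_or_eventually_ne_zero with h0 | h0
  · right
    filter_upwards [h0, hmem] with z hz hzr hzρ
    obtain ⟨y, hy, hy0⟩ := hker z hzr hz
    have hinj := (ContinuousLinearMap.isUnit_iff_bijective.1 (h.mem_resolventSet_iff.1 hzρ)).1
    exact hy (hinj (hy0.trans (_root_.map_zero _).symm))
  · left
    filter_upwards [h0, mem_nhdsWithin_of_mem_nhds hmem] with z hz hzr
    exact h.mem_resolventSet_iff.2 (hunit z hzr hz).1

/-- The kernel at c yields an eigenvector. In the contour integral the holomorphic part of the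
resolvent drops out by Cauchy, leaving a pole term that factors through a finite-dimensional space.
-/
theorem mem_discreteSpectrum (h : IsQuotient T L R) {c : ℂ}
    (hN : IsUnitAddCompact (L - c • R)) (hc : c ∉ T.resolventSet)
    (hiso : ∀ᶠ z in 𝓝[≠] c, z ∈ T.resolventSet) : c ∈ T.discreteSpectrum := by
  obtain ⟨V, hV, r, d, Γ, Φ, Ψ, hr, hd, hΓ, hΦ, hΨ, hunit, hker⟩ :=
    IsUnitAddCompact.exists_local_inverse (N := fun z => L - z • R) (by fun_prop) hN
  have hdc : d c = 0 := by
    by_contra h0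
    exact hc (h.mem_resolventSet_iff.2 (hunit c (mem_ball_self hr) h0).1)
  obtain ⟨y, hy, hy0⟩ := hker c (mem_ball_self hr) hdc
  have hmem := ball_mem_nhds c hr
  have hd0 : ∀ᶠ z in 𝓝[≠] c, d z ≠ 0 := by
    filter_upwards [hiso, mem_nhdsWithin_of_mem_nhds hmem] with z hz hzr h0
    obtain ⟨y, hy, hy0⟩ := hker z hzr h0
    have hinj := (ContinuousLinearMap.isUnit_iff_bijective.1 (h.mem_resolventSet_iff.1 hz)).1
    exact hy (hinj (hy0.trans (_root_.map_zero _).symm))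
  obtain ⟨m, g, hg, hgc, hdg⟩ := (hd.analyticAt hmem).exists_eq_pow_smul hd0
  have hev : ∀ᶠ z in 𝓝 c, (z ≠ c → z ∈ T.resolventSet) ∧ (z ≠ c → d z ≠ 0) ∧
      d z = (z - c) ^ m * g z ∧ DifferentiableAt ℂ g z ∧ g z ≠ 0 ∧ z ∈ ball c r := by
    filter_upwards [eventually_nhdsWithin_iff.1 hiso, eventually_nhdsWithin_iff.1 hd0, hdg,
      hg.eventually_analyticAt, hg.continuousAt.eventually_ne hgc, hmem] with z h1 h2 h3 h4 h5 h6
    exact ⟨h1, h2, h3, h4.differentiableAt, h5, h6⟩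
  obtain ⟨ρ, hρ, hball⟩ := Metric.eventually_nhds_iff_ball.1 hev
  have hρr : ball c ρ ⊆ ball c r := fun z hz => (hball z hz).2.2.2.2.2
  have hε : 0 < ρ / 2 := half_pos hρ
  have hερ : ρ / 2 < ρ := half_lt_self hρ
  have hsub : closedBall c (ρ / 2) ⊆ ball c ρ := closedBall_subset_ball hερ
  have hsph : sphere c (ρ / 2) ⊆ ball c ρ := sphere_subset_closedBall.trans hsub
  refine ⟨h.mem_pointSpectrum hy hy0, ρ / 2, hε, ?_, ?_⟩
  · ext z
    constructor
    · rintro ⟨hz, hzσ⟩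
      by_contra hzc
      exact hzσ ((hball z (hsub hz)).1 hzc)
    · rintro rfl
      exact ⟨mem_closedBall_self hε.le, hc⟩
  -- The nonvanishing factor g of d = (z - c)ᵐg is absorbed here, leaving a pure power in the
  -- denominator.
  · let Φ' : ℂ → V →L[ℂ] K := fun z => (g z)⁻¹ • (R ∘L Φ z)
    have hΦ' : DifferentiableOn ℂ Φ' (ball c ρ) :=
      DifferentiableOn.smul (fun z hz =>
        ((hball z hz).2.2.2.1.inv (hball z hz).2.2.2.2.1).differentiableWithinAt)
        ((differentiableOn_const R).clm_comp (hΦ.mono hρr))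
    have hΨ' := hΨ.mono hρr
    have hRΓ : DifferentiableOn ℂ (fun z => R ∘L Γ z) (ball c ρ) :=
      (differentiableOn_const R).clm_comp (hΓ.mono hρr)
    have hne : ∀ z ∈ sphere c (ρ / 2), z ≠ c := fun z hz => ne_of_mem_sphere hz hε.ne'
    have hcont : ContinuousOn (fun z => ((z - c) ^ m)⁻¹ • (Φ' z ∘L Ψ z)) (sphere c (ρ / 2)) :=
      (ContinuousOn.inv₀ (by fun_prop) fun z hz => pow_ne_zero _ (sub_ne_zero.2 (hne z hz))).smul
        ((hΦ'.continuousOn.mono hsph).clm_comp (hΨ'.continuousOn.mono hsph))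
    have hint : (∮ z in C(c, ρ / 2), resolvent T z) =
        - ∮ z in C(c, ρ / 2), ((z - c) ^ m)⁻¹ • (Φ' z ∘L Ψ z) := by
      have h0 : (∮ z in C(c, ρ / 2), R ∘L Γ z) = 0 :=
        (hRΓ.diffContOnCl_ball hsub).circleIntegral_eq_zero hε.le
      rw [← zero_sub, ← h0, ← circleIntegral.integral_sub
        ((hRΓ.continuousOn.mono hsph).circleIntegrable hε.le) (hcont.circleIntegrable hε.le)]
      refine circleIntegral.integral_congr hε.le fun z hz => ?_
      obtain ⟨h1, h2, h3, -, h5, h6⟩ := hball z (hsph hz)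
      obtain ⟨h7, h8⟩ := hunit z h6 (h2 (hne z hz))
      simp only [Φ']
      rw [h.resolvent_eq h7, h8, h3, mul_sub, mul_smul_comm, ContinuousLinearMap.smul_comp,
        smul_smul, mul_inv]
      rfl
    have hfin := finiteDimensional_range_circleIntegral hε hερ hΨ' m hΦ'
    refine Submodule.finiteDimensional_of_le (S₂ := LinearMap.range
      ((∮ z in C(c, ρ / 2), ((z - c) ^ m)⁻¹ • (Φ' z ∘L Ψ z) : K →L[ℂ] K) : K →ₗ[ℂ] K)) ?_
    rintro _ ⟨x, rfl⟩
    simp only [rieszProjection, hint]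
    exact Submodule.smul_mem _ _ (Submodule.neg_mem _ ⟨x, rfl⟩)

/-- A contour integral S inverts the pencil at c on the right up to the finite-rank Riesz
projection, and c is a limit of points where the pencil is invertible. -/
theorem isUnitAddCompact_of_mem_discreteSpectrum (h : IsQuotient T L R) {c : ℂ}
    (hc : c ∈ T.discreteSpectrum) : IsUnitAddCompact (L - c • R) := by
  obtain ⟨-, ε, hε, hball, hfin⟩ := hc
  have hρ : ∀ z ∈ closedBall c ε, z ≠ c → IsUnit (L - z • R) := fun z hz hzc => by
    refine h.mem_resolventSet_iff.1 (by_contra fun hzρ => hzc ?_)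
    have : z ∈ closedBall c ε ∩ T.spectrum := ⟨hz, hzρ⟩
    rwa [hball] at this
  have hne : ∀ z ∈ sphere c ε, z ≠ c := fun z hz => ne_of_mem_sphere hz hε.ne'
  have hunit : ∀ z ∈ sphere c ε, IsUnit (L - z • R) := fun z hz =>
    hρ z (sphere_subset_closedBall hz) (hne z hz)
  have hcont : ContinuousOn (fun z => Ring.inverse (L - z • R)) (sphere c ε) := fun z hz => by
    obtain ⟨u, hu⟩ := hunit z hz
    have h1 : ContinuousAt Ring.inverse (L - z • R) := hu ▸ NormedRing.inverse_continuousAt u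
    exact (ContinuousAt.comp (f := fun z => L - z • R) h1 (by fun_prop)).continuousWithinAt
  have hinv : ContinuousOn (fun z : ℂ => (z - c)⁻¹) (sphere c ε) :=
    ContinuousOn.inv₀ (by fun_prop) fun z hz => sub_ne_zero.2 (hne z hz)
  have hRcont : ContinuousOn (fun z => R ∘L Ring.inverse (L - z • R)) (sphere c ε) :=
    continuousOn_const.clm_comp hcont
  -- From L - cR = (L - zR) + (z - c)R, multiplying the integrand by L - cR gives (z - c)⁻¹ + R(L -
  -- zR)⁻¹: the scalar 2πi plus the integral of the resolvent.
  let S : K →L[ℂ] K := ∮ z in C(c, ε), (z - c)⁻¹ • Ring.inverse (L - z • R)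
  have hS : (L - c • R) * S = (2 * Real.pi * Complex.I : ℂ) • 1 + ∮ z in C(c, ε), resolvent T z := by
    have h1 : (∮ z in C(c, ε), resolvent T z) = ∮ z in C(c, ε), R ∘L Ring.inverse (L - z • R) :=
      circleIntegral.integral_congr hε.le fun z hz => h.resolvent_eq (hunit z hz)
    have h2 : (∮ z in C(c, ε), (z - c)⁻¹ • (1 : K →L[ℂ] K)) = (2 * Real.pi * Complex.I : ℂ) • 1 := by
      rw [circleIntegral.integral_smul_const, circleIntegral.integral_sub_center_inv c hε.ne']
    have h3 : ContinuousOn (fun z : ℂ => (z - c)⁻¹ • (1 : K →L[ℂ] K)) (sphere c ε) :=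
      hinv.smul continuousOn_const
    rw [h1, ← h2, ← circleIntegral.integral_add (h3.circleIntegrable hε.le) (hRcont.circleIntegrable hε.le)]
    refine ((L - c • R).comp_circleIntegral hε.le (hinv.smul hcont)).symm.trans
      (circleIntegral.integral_congr hε.le fun z hz => ?_)
    have h3 : L - c • R = (L - z • R) + (z - c) • R := by rw [sub_smul]; abel
    have h4 := Ring.mul_inverse_cancel _ (hunit z hz)
    have h5 : z - c ≠ 0 := sub_ne_zero.2 (hne z hz)
    change (L - c • R) * ((z - c)⁻¹ • Ring.inverse (L - z • R)) =
      (z - c)⁻¹ • 1 + R * Ring.inverse (L - z • R)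
    rw [mul_smul_comm, h3, add_mul, h4, smul_add, smul_mul_assoc, smul_smul,
      inv_mul_cancel₀ h5, one_smul]
  have h2π : (2 * Real.pi * Complex.I : ℂ) ≠ 0 := Complex.two_pi_I_ne_zero
  refine IsUnitAddCompact.of_mul_eq_one_sub (S := (2 * Real.pi * Complex.I : ℂ)⁻¹ • S)
    (P := rieszProjection T c ε) (R := R) ?_ (isCompactOperator_of_finiteDimensional_range hfin) ?_
  · rw [mul_smul_comm, hS, smul_add, smul_smul, inv_mul_cancel₀ h2π, one_smul, rieszProjection,
      neg_div, one_div, neg_smul, sub_neg_eq_add]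
  · have hev : ∀ᶠ t : ℂ in 𝓝[≠] 0, IsUnit (L - c • R - t • R) := by
      filter_upwards [self_mem_nhdsWithin,
        mem_nhdsWithin_of_mem_nhds (ball_mem_nhds (0 : ℂ) hε)] with t ht htε
      have := hρ (c + t) (by simpa using (mem_ball_zero_iff.1 htε).le) (by simpa using ht)
      rwa [add_smul, ← sub_sub] at this
    exact hev.frequently.filter_mono nhdsWithin_le_nhds

end LinearPMap.IsQuotient

/-! ### Stability of the extended resolvent set. -/

namespace LinearPMap

variable {K : Type*} [NormedAddCommGroup K] [InnerProductSpace ℂ K]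

theorem add_add_neg_of_domain_le {A B : K →ₗ.[ℂ] K} (h : A.domain ≤ B.domain) :
    A + B + -B = A := by
  refine LinearPMap.ext ?_ ?_
  · simpa [add_domain, neg_domain] using h
  · rintro x hx hx'
    exact add_neg_cancel_right (A ⟨x, hx'⟩) (B ⟨x, h hx'⟩)

variable [CompleteSpace K]

theorem IsQuotient.isUnitAddCompact_of_mem_extendedResolventSet {T : K →ₗ.[ℂ] K} {L R : K →L[ℂ] K}
    (h : IsQuotient T L R) {c : ℂ} (hc : c ∈ T.extendedResolventSet) :
    IsUnitAddCompact (L - c • R) :=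
  hc.elim (fun hc => (h.mem_resolventSet_iff.1 hc).isUnitAddCompact)
    h.isUnitAddCompact_of_mem_discreteSpectrum

/-- The two Fredholm alternatives define disjoint open sets covering the component, so connectedness
and one resolvent point select the first. -/
theorem extendedResolventSet_subset_add {A B : K →ₗ.[ℂ] K} {w : ℂ} (hw : w ∈ A.resolventSet)
    (hB : IsCompactMulResolventAt A B w)
    (h : ∀ z ∈ A.extendedResolventSet,
      (connectedComponentIn A.extendedResolventSet z ∩ (A + B).resolventSet).Nonempty) :
    A.extendedResolventSet ⊆ (A + B).extendedResolventSet := by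
  obtain ⟨C, hC, hCB⟩ := hB
  have hA := isQuotient_self hw
  have hAB := isQuotient_add hw hCB
  have hcpt : ∀ z ∈ A.extendedResolventSet,
      IsUnitAddCompact (1 + w • resolvent A w + C - z • resolvent A w) := fun z hz => by
    rw [add_sub_right_comm]
    exact (hA.isUnitAddCompact_of_mem_extendedResolventSet hz).add_isCompactOperator hC
  intro z hz
  obtain ⟨z', hz', hz'ρ⟩ := h z hz
  have hsub : connectedComponentIn A.extendedResolventSet z ⊆
      {x | ∀ᶠ y in 𝓝[≠] x, y ∈ (A + B).resolventSet} := by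
    refine isPreconnected_connectedComponentIn.subset_left_of_subset_union
      (v := {x | ∀ᶠ y in 𝓝 x, y ∉ (A + B).resolventSet}) ?_ ?_ ?_ ?_ ?_
    · refine isOpen_iff_mem_nhds.2 fun x hx => ?_
      filter_upwards [eventually_eventually_nhds.2 (eventually_nhdsWithin_iff.1 hx)] with y hy
      by_cases hyx : y = x
      · rwa [hyx]
      · have := hy.and (isOpen_ne.mem_nhds hyx)
        exact mem_nhdsWithin_of_mem_nhds (this.mono fun u hu => hu.1 hu.2)
    · exact isOpen_iff_mem_nhds.2 fun x hx => eventually_eventually_nhds.2 hx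
    · refine Set.disjoint_left.2 fun x hx hx' => ?_
      have h1 : ∀ᶠ y in 𝓝[≠] x, y ∈ (A + B).resolventSet := hx
      have h2 : ∀ᶠ y in 𝓝 x, y ∉ (A + B).resolventSet := hx'
      obtain ⟨y, hy, hy'⟩ := (h1.and (h2.filter_mono nhdsWithin_le_nhds)).exists
      exact hy' hy
    · exact fun x hx => hAB.eventually_mem_resolventSet_or
        (hcpt x (connectedComponentIn_subset _ _ hx))
    · exact ⟨z', hz', mem_nhdsWithin_of_mem_nhds (hAB.isOpen_resolventSet.mem_nhds hz'ρ)⟩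
  by_cases hzρ : z ∈ (A + B).resolventSet
  · exact Or.inl hzρ
  · exact Or.inr (hAB.mem_discreteSpectrum (hcpt z hz) hzρ (hsub (mem_connectedComponentIn hz)))

/-- The resolvent of A + B at `w'` is R X with X bounded, so -B composed with it is -CX. -/
theorem IsCompactMulResolventAt.neg_add {A B : K →ₗ.[ℂ] K} {w w' : ℂ} (hw : w ∈ A.resolventSet)
    (hB : IsCompactMulResolventAt A B w) (hw' : w' ∈ (A + B).resolventSet) :
    IsCompactMulResolventAt (A + B) (-B) w' := by
  obtain ⟨C, hC, hCB⟩ := hB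
  have hAB := isQuotient_add hw hCB
  rw [IsCompactMulResolventAt, hAB.resolvent_eq (hAB.mem_resolventSet_iff.1 hw')]
  set X := Ring.inverse (1 + w • resolvent A w + C - w' • resolvent A w)
  refine ⟨-(C * X), (hC.comp_clm X).neg, fun y => ?_⟩
  rw [neg_graph]
  exact ⟨_, hCB (X y), rfl⟩

end LinearPMap

theorem corollary6p4 {K : Type*} [NormedAddCommGroup K] [InnerProductSpace ℂ K] [CompleteSpace K]
    [TopologicalSpace.SeparableSpace K]
    (A B : K →ₗ.[ℂ] K) (hA : A.IsClosed) (hρ : A.resolventSet.Nonempty)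
    (hdom : A.domain ≤ B.domain)
    (hcomp : ∃ z ∈ A.resolventSet, LinearPMap.IsCompactMulResolventAt A B z)
    (h₁ : ∀ z ∈ A.extendedResolventSet,
      (connectedComponentIn A.extendedResolventSet z ∩ (A + B).resolventSet).Nonempty)
    (h₂ : ∀ z ∈ (A + B).extendedResolventSet,
      (connectedComponentIn (A + B).extendedResolventSet z ∩ A.resolventSet).Nonempty) :
    (A + B).extendedResolventSet = A.extendedResolventSet ∧
      (A + B).essentialSpectrum = A.essentialSpectrum := by
  obtain ⟨w, hw, hB⟩ := hcomp
  -- The component hypothesis at `w` also shows that A + B has a resolvent point, as needed to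
  -- exchange the roles of A and A + B.
  obtain ⟨w', -, hw'⟩ := h₁ w (Or.inl hw)
  have hAB := LinearPMap.add_add_neg_of_domain_le hdom
  have hsub := LinearPMap.extendedResolventSet_subset_add hw' (hB.neg_add hw hw')
    (by rwa [hAB])
  rw [hAB] at hsub
  have heq := hsub.antisymm (LinearPMap.extendedResolventSet_subset_add hw hB h₁)
  have hess : ∀ T : K →ₗ.[ℂ] K, T.essentialSpectrum = T.extendedResolventSetᶜ := fun T => by
    rw [LinearPMap.essentialSpectrum, LinearPMap.extendedResolventSet, LinearPMap.spectrum,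
      Set.compl_union, Set.sdiff_eq]
  exact ⟨heq, by rw [hess, hess, heq]⟩
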